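/- Let $G$ be a finitely generated virtually free group, i.e. $G$ is finitely generated and has a finite-index subgroup that is a free group. Let $S$ be any finite generating set of $G$. For a finite alphabet $A$ and a finite set $\mathcal F\subseteq A\times A\times S$ of nearest neighbor forbidden patterns, let $$X_{\mathcal F}=\{x\colon G\to A \;:\; \text{there are no } g\in G \text{ and } (a,b,s)\in\mathcal F \text{ with } x(g)=a \text{ and } x(gs)=b\}.$$ Then both of the following decision problems, whose input is a finite alphabet $A$, a finite set $\mathcal F\subseteq A\times A\times S$ and a letter $a_0\in A$, are decidable: 1. the seeded domino problem $\mathrm{SDP}(G,S)$: is there $x\in X_{\mathcal F}$ with $x(1_G)=a_0$? 2. the recurring domino problem $\mathrm{RDP}(G,S)$: is there $x\in X_{\mathcal F}$ such that $\{g\in G : x(g)=a_0\}$ is infinite? In other words, $\mathrm{SDP}(G)$ and $\mathrm{RDP}(G)$ are decidable. -/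

import Mathlib

/-- A group is virtually free if it has a free subgroup of finite index. -/
def VirtuallyFree (G : Type*) [Group G] : Prop :=
  ∃ H : Subgroup G, H.FiniteIndex ∧ IsFreeGroup H

/-- The nearest neighbor subshift `X_F ⊆ A ^ G` defined by a set `F` of forbidden patterns, with
respect to a family `s` of elements of `G`. The tuple `(a, b, i)` stands for the pattern `p` with
support `{1, s i}`, `p 1 = a` and `p (s i) = b`; it appears in `x` if for some `g`,
`x (g * h) = p h` for all `h` in the support. -/
def nnSubshift {G ι A : Type*} [Group G] (s : ι → G) (F : Set (A × A × ι)) : Set (G → A) :=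
  {x | ∀ a b i, (a, b, i) ∈ F → ¬ ∃ g : G, x g = a ∧ x (g * s i) = b}

/-- Finite inputs for the seeded and recurring domino problems over `d` generators: a triple
`(n, F, a₀)` of a natural number `n`, encoding the alphabet `{0, …, n - 1}`, a finite list `F` of
nearest neighbor patterns `(a, b, i)`, and a letter `a₀`. -/
abbrev DominoInput (d : ℕ) : Type := ℕ × List (ℕ × ℕ × Fin d) × ℕ

/-- The patterns over the alphabet `Fin n` that are listed in an input. Listed tuples using a
number that is not a letter of the alphabet are not patterns over it, and are disregarded. -/
def DominoInput.patterns {d : ℕ} (I : DominoInput d) : Set (Fin I.1 × Fin I.1 × Fin d) :=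
  {p | ((p.1 : ℕ), (p.2.1 : ℕ), p.2.2) ∈ I.2.1}

/-- The yes-instances of the seeded domino problem on `G` with respect to `s`: the target is a
letter of the alphabet and some configuration of the subshift carries it at the identity. -/
def SDP {G : Type*} [Group G] {d : ℕ} (s : Fin d → G) (I : DominoInput d) : Prop :=
  ∃ a₀ : Fin I.1, (a₀ : ℕ) = I.2.2 ∧ ∃ x ∈ nnSubshift s I.patterns, x 1 = a₀

/-- The yes-instances of the recurring domino problem on `G` with respect to `s`: the target is a
letter of the alphabet and occurs infinitely often in some configuration of the subshift. -/
def RDP {G : Type*} [Group G] {d : ℕ} (s : Fin d → G) (I : DominoInput d) : Prop :=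
  ∃ a₀ : Fin I.1, (a₀ : ℕ) = I.2.2 ∧ ∃ x ∈ nnSubshift s I.patterns, {g : G | x g = a₀}.Infinite

/-- `SDP(G)` is decidable: with respect to every finite generating set `{s 0, …, s (d - 1)}`, there
is an algorithm that decides the seeded domino problem, uniformly in the alphabet, the forbidden
patterns and the target letter. -/
def SDPDecidable (G : Type*) [Group G] : Prop :=
  ∀ (d : ℕ) (s : Fin d → G), Subgroup.closure (Set.range s) = ⊤ →
    ComputablePred (fun I : DominoInput d => SDP s I)

/-- `RDP(G)` is decidable, with respect to every finite generating set. -/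
def RDPDecidable (G : Type*) [Group G] : Prop :=
  ∀ (d : ℕ) (s : Fin d → G), Subgroup.closure (Set.range s) = ⊤ →
    ComputablePred (fun I : DominoInput d => RDP s I)

/-!
A free subgroup of finite index in a finitely generated group has finite rank, so `G` is in
bijection with `FreeGroup (Fin m) × Fin k` through `(h, t) ↦ (φ h)⁻¹ * τ t`. Right multiplication
by a generator of `G` moves `(h, t)` to some `(c * h, t')` where `c` and `t'` depend on `t` and the
generator only. Hence a configuration on `G` is a labelling of the Cayley tree of the free group
whose rules have bounded range. Recording at every vertex the letters of a large enough ball, its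
*bag*, turns the rules into nearest neighbour rules (`bagRules`), because bags that agree with
their neighbours wherever they overlap come from a global configuration (`bagLetter_labelling`).

On a tree, nearest neighbour rules are understood through the *live* labels, those of the largest
set of allowed labels in which every label can be continued along every letter: a label occurs in
some labelling if and only if it is live (`TreeRules.exists_labelling_iff`). Labels satisfying `P`
occur infinitely often in some labelling if and only if the finite graph of live labels, with the
letters by which they are entered, contains a cycle and a path from a vertex of the cycle to a
label satisfying `P` that leaves the cycle at once or is trivial
(`TreeRules.exists_labelling_infinite_iff`). Going around such a cycle forever, with one excursion
to the target per round, gives infinitely many occurrences. Conversely, infinitely many occurrences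
lie behind every vertex of some ray, by König's lemma; two passages of the ray through the same
label, with an occurrence that lies behind the first and not behind the second, yield the cycle and
the path.

Both criteria speak about elements and subsets of a finite set of labels. Labels are coded by base
`n` digits and sets of labels by binary digits of numbers below a primitive recursive bound, so
that the criteria become formulas with bounded quantifiers, which define primitive recursive
predicates (`TreeRules.PrimrecFamily.exists_live`, `TreeRules.PrimrecFamily.recurrent`).
-/

/-! ### Nearest neighbour rules on the Cayley tree of a free group -/

/-- Nearest neighbour rules for labellings of the Cayley tree of `FreeGroup α`: the labels allowed
at a vertex, and the pairs of labels allowed along an edge carrying the letter `e`. The edge from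
`h` to `e * h` is also the edge carrying the inverse letter from `e * h` to `h`, whence `symm`. -/
structure TreeRules (α Q : Type*) where
  /-- The labels allowed at a vertex. -/
  V : Q → Prop
  /-- The pairs of labels allowed along an edge. -/
  R : α × Bool → Q → Q → Prop
  symm : ∀ e σ τ, R e σ τ → R (e.1, !e.2) τ σ

namespace TreeRules

variable {α Q : Type*} (T : TreeRules α Q)

/-- A labelling of the free group that obeys the rules. Neighbours of `h` are the elements `e * h`,
so that the path from `1` to `h` reads the reduced word of `h` from its last letter to its first. -/
def Labelling (f : FreeGroup α → Q) : Prop :=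
  (∀ h, T.V (f h)) ∧ ∀ h e, T.R e (f h) (f (FreeGroup.mk [e] * h))

/-- A label is live if it belongs to a set of allowed labels in which every label has a successor
along each letter. -/
def Live (σ : Q) : Prop :=
  ∃ S : Set Q, σ ∈ S ∧ ∀ τ ∈ S, T.V τ ∧ ∀ e, ∃ υ ∈ S, T.R e τ υ

/-- Passage from a vertex to a child in the tree of reduced words, recorded by the labels of the two
vertices and the letters of the edges by which they are entered from their parents. -/
def Step (p q : Q × (α × Bool)) : Prop :=
  T.Live p.1 ∧ T.Live q.1 ∧ q.2 ≠ (p.2.1, !p.2.2) ∧ T.R q.2 p.1 q.1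

variable {T}

lemma Live.v {σ : Q} (h : T.Live σ) : T.V σ := by
  obtain ⟨S, hσ, hS⟩ := h
  exact (hS σ hσ).1

lemma Live.exists_next {σ : Q} (h : T.Live σ) (e : α × Bool) : ∃ τ, T.Live τ ∧ T.R e σ τ := by
  obtain ⟨S, hσ, hS⟩ := h
  obtain ⟨τ, hτ, hR⟩ := (hS σ hσ).2 e
  exact ⟨τ, ⟨S, hτ, hS⟩, hR⟩

variable (T) in
lemma exists_next_fun :
    ∃ next : α × Bool → Q → Q, ∀ e τ, T.Live τ → T.Live (next e τ) ∧ T.R e τ (next e τ) := by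
  have hn : ∀ (e : α × Bool) (τ : Q), ∃ υ, T.Live τ → T.Live υ ∧ T.R e τ υ := by
    intro e τ
    by_cases hτ : T.Live τ
    · obtain ⟨υ, hυ⟩ := hτ.exists_next e
      exact ⟨υ, fun _ => hυ⟩
    · exact ⟨τ, fun h => absurd h hτ⟩
  choose next hnext using hn
  exact ⟨next, hnext⟩

lemma Labelling.live {f : FreeGroup α → Q} (hf : T.Labelling f) (h : FreeGroup α) :
    T.Live (f h) := by
  refine ⟨Set.range f, ⟨h, rfl⟩, ?_⟩
  rintro _ ⟨k, rfl⟩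
  exact ⟨hf.1 k, fun e => ⟨_, ⟨_, rfl⟩, hf.2 k e⟩⟩

/-- A deterministic top-down automaton on the tree of reduced words whose moves obey the rules
produces a labelling of the whole free group. -/
lemma labelling_of_automaton [DecidableEq α] {D : Type*} (lab : D → Q) (step : α × Bool → D → D)
    (I : D → Prop) (d₀ : D) (h₀ : I d₀) (hstep : ∀ e d, I d → I (step e d))
    (hV : ∀ d, I d → T.V (lab d)) (hR : ∀ e d, I d → T.R e (lab d) (lab (step e d))) :
    T.Labelling (fun h => lab (h.toWord.foldr step d₀)) := by
  have hI : ∀ w : List (α × Bool), I (w.foldr step d₀) := by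
    intro w
    induction w with
    | nil => exact h₀
    | cons e w ih => exact hstep _ _ ih
  refine ⟨fun h => hV _ (hI _), fun h e => ?_⟩
  have hw : (FreeGroup.mk [e] * h).toWord = FreeGroup.reduce (e :: h.toWord) := by
    conv_lhs => rw [← FreeGroup.mk_toWord (x := h)]
    rw [FreeGroup.mul_mk, FreeGroup.toWord_mk]
    rfl
  simp only [hw]
  rw [FreeGroup.reduce.cons, FreeGroup.reduce_toWord]
  have hI' := hI h.toWord
  cases hh : h.toWord with
  | nil => exact hR _ _ h₀
  | cons a tl =>
    rw [hh] at hI'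
    by_cases hc : e.1 = a.1 ∧ e.2 = !a.2
    · have he : e = (a.1, !a.2) := Prod.ext hc.1 hc.2
      simp only [hc, and_self, if_true]
      rw [he]
      exact T.symm _ _ _ (hR a _ (hI tl))
    · simp only [hc, if_false]
      exact hR e _ hI'

/-- Every live label is the label of the identity in some labelling. -/
lemma Live.exists_labelling {σ : Q} (hσ : T.Live σ) : ∃ f, T.Labelling f ∧ f 1 = σ := by
  classical
  obtain ⟨next, hnext⟩ := exists_next_fun T
  refine ⟨_, labelling_of_automaton (T := T) id next T.Live σ hσ
    (fun e d hd => (hnext e d hd).1) (fun d hd => hd.v) (fun e d hd => (hnext e d hd).2), ?_⟩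
  simp

theorem exists_labelling_iff (P : Q → Prop) :
    (∃ f, T.Labelling f ∧ ∃ h, P (f h)) ↔ ∃ σ, T.Live σ ∧ P σ := by
  constructor
  · rintro ⟨f, hf, h, hP⟩
    exact ⟨_, hf.live h, hP⟩
  · rintro ⟨σ, hσ, hP⟩
    obtain ⟨f, hf, rfl⟩ := hσ.exists_labelling
    exact ⟨f, hf, 1, hP⟩

/-! ### Labellings with infinitely many occurrences -/

variable (T) in
/-- The finite pattern that makes infinitely many occurrences possible: a cycle
`p → q → ⋯ → p` of `Step` together with a path from `p` to a label satisfying `P` that is trivial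
or leaves the cycle at `p`. -/
def Recurrent (P : Q → Prop) : Prop :=
  ∃ p q t, T.Step p q ∧ Relation.ReflTransGen T.Step q p ∧ P t.1 ∧
    (t = p ∨ ∃ r, T.Step p r ∧ r.2 ≠ q.2 ∧ Relation.ReflTransGen T.Step r t)

/-- The word `w` is reduced, and stays so when a letter other than the inverse of `a` is put in
front of it. -/
def FollowableBy (w : List (α × Bool)) (a : α × Bool) : Prop :=
  FreeGroup.IsReduced w ∧ ∀ b : α × Bool, b ≠ (a.1, !a.2) → FreeGroup.IsReduced (b :: w)

lemma followableBy_cons {w : List (α × Bool)} {a : α × Bool} (h : FreeGroup.IsReduced (a :: w)) :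
    FollowableBy (a :: w) a := by
  refine ⟨h, fun b hb => ?_⟩
  rw [FreeGroup.isReduced_cons_cons]
  refine ⟨fun h1 => ?_, h⟩
  by_contra h2
  exact hb (Prod.ext h1 (by grind))

lemma followableBy_nil (a : α × Bool) : FollowableBy [] a :=
  ⟨FreeGroup.IsReduced.nil, fun _ _ => FreeGroup.IsReduced.singleton⟩

section Automaton

variable (T)

open Classical in
/-- One move along a planned path: if the plan `l` starts with a legal move along `e`, the new label
and the remaining plan. -/
noncomputable def advance (e : α × Bool) (σ : Q) (l : List (Q × (α × Bool))) :
    Option (Q × List (Q × (α × Bool))) :=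
  match l with
  | [] => none
  | p :: l => if p.2 = e ∧ T.Live p.1 ∧ T.R e σ p.1 then some (p.1, l) else none

open Classical in
/-- The automaton that goes around a cycle forever and leaves it once per round towards a target.
A state consists of a label and of the remaining plans for the cycle and for the excursion; on
completing the cycle the automaton returns to its initial state `d₀`, and off both plans it
continues by `next`. -/
noncomputable def move (next : α × Bool → Q → Q)
    (d₀ : Q × List (Q × (α × Bool)) × List (Q × (α × Bool)))
    (e : α × Bool) (d : Q × List (Q × (α × Bool)) × List (Q × (α × Bool))) :
    Q × List (Q × (α × Bool)) × List (Q × (α × Bool)) :=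
  match T.advance e d.1 d.2.1, T.advance e d.1 d.2.2 with
  | some (σ, l), _ => if l = [] ∧ σ = d₀.1 then d₀ else (σ, l, [])
  | none, some (σ, l) => (σ, [], l)
  | none, none => (next e d.1, [], [])

variable {T}

lemma advance_some {e : α × Bool} {σ τ : Q} {l l' : List (Q × (α × Bool))}
    (h : T.advance e σ l = some (τ, l')) : T.Live τ ∧ T.R e σ τ := by
  cases l with
  | nil => simp [advance] at h
  | cons p l =>
    simp only [advance, Option.ite_none_right_eq_some, Option.some.injEq, Prod.mk.injEq] at h
    obtain ⟨h1, rfl, rfl⟩ := h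
    exact h1.2

lemma advance_of_step {p : Q × (α × Bool)} {q : Q × (α × Bool)} (h : T.Step p q)
    (l : List (Q × (α × Bool))) : T.advance q.2 p.1 (q :: l) = some (q.1, l) := by
  exact if_pos ⟨rfl, h.2.1, h.2.2.2⟩

variable {next : α × Bool → Q → Q} {d₀ : Q × List (Q × (α × Bool)) × List (Q × (α × Bool))}

lemma move_spec (hnext : ∀ e τ, T.Live τ → T.Live (next e τ) ∧ T.R e τ (next e τ))
    (e : α × Bool) (d : Q × List (Q × (α × Bool)) × List (Q × (α × Bool)))
    (hd : T.Live d.1) :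
    T.Live (T.move next d₀ e d).1 ∧ T.R e d.1 (T.move next d₀ e d).1 := by
  unfold move
  split
  next σ l h =>
    split_ifs with hc
    · rw [← hc.2]
      exact advance_some h
    · exact advance_some h
  next σ l _ h => exact advance_some h
  next => exact hnext e d.1 hd

open Classical in
/-- Along the planned cycle the automaton comes back to its initial state. -/
lemma exists_word_of_cycle {a : α × Bool} (l : List (Q × (α × Bool))) :
    ∀ (p : Q × (α × Bool)) (l₂ : List (Q × (α × Bool))) (w : List (α × Bool)), l ≠ [] →
      List.IsChain T.Step (p :: l) → (∀ hl : l ≠ [], l.getLast hl = (d₀.1, a)) →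
      FollowableBy w p.2 → w.foldr (T.move next d₀) d₀ = (p.1, l, l₂) →
      ∃ w', FollowableBy w' a ∧ w'.foldr (T.move next d₀) d₀ = d₀ ∧ w.length < w'.length := by
  induction l with
  | nil => intro p l₂ w h; exact absurd rfl h
  | cons q l ih =>
    intro p l₂ w _ hc hlast hw hrun
    rw [List.isChain_cons_cons] at hc
    have hred := hw.2 q.2 hc.1.2.2.1
    have hmove : (q.2 :: w).foldr (T.move next d₀) d₀ =
        if l = [] ∧ q.1 = d₀.1 then d₀ else (q.1, l, []) := by
      rw [List.foldr_cons, hrun]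
      simp only [move, advance_of_step hc.1]
    rcases eq_or_ne l [] with hl | hl
    · subst hl
      have hq : q = (d₀.1, a) := by simpa using hlast
      refine ⟨q.2 :: w, ?_, ?_, by simp⟩
      · have := followableBy_cons hred
        rw [hq] at this ⊢
        exact this
      · rw [hmove, if_pos ⟨rfl, by rw [hq]⟩]
    · rw [if_neg (fun h => hl h.1)] at hmove
      obtain ⟨w', h1, h2, h3⟩ := ih q [] (q.2 :: w) hl hc.2
        (fun h => by rw [← hlast (by simp), List.getLast_cons h]) (followableBy_cons hred) hmove
      exact ⟨w', h1, h2, by simp at h3; omega⟩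

/-- Along the planned excursion the automaton reaches its target. -/
lemma exists_word_of_excursion (l : List (Q × (α × Bool))) :
    ∀ (p : Q × (α × Bool)) (l₁ : List (Q × (α × Bool))) (w : List (α × Bool)),
      List.IsChain T.Step (p :: l) → (∀ q ∈ l.head?, ∀ r ∈ l₁.head?, q.2 ≠ r.2) →
      FollowableBy w p.2 → w.foldr (T.move next d₀) d₀ = (p.1, l₁, l) →
      ∃ w', FreeGroup.IsReduced w' ∧
        (w'.foldr (T.move next d₀) d₀).1 = ((p :: l).getLast (by simp)).1 ∧
        w.length ≤ w'.length := by
  induction l with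
  | nil =>
    intro p l₁ w _ _ hw hrun
    exact ⟨w, hw.1, by simp [hrun], le_rfl⟩
  | cons q l ih =>
    intro p l₁ w hc hl₁ hw hrun
    rw [List.isChain_cons_cons] at hc
    have hred := hw.2 q.2 hc.1.2.2.1
    have hnone : T.advance q.2 p.1 l₁ = none := by
      cases l₁ with
      | nil => rfl
      | cons r l₁ =>
        have : r.2 ≠ q.2 := fun h => hl₁ q (by simp) r (by simp) h.symm
        simp [advance, this]
    have hmove : (q.2 :: w).foldr (T.move next d₀) d₀ = (q.1, [], l) := by
      rw [List.foldr_cons, hrun]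
      simp only [move, advance_of_step hc.1, hnone]
    obtain ⟨w', h1, h2, h3⟩ := ih q [] (q.2 :: w) hc.2 (by simp) (followableBy_cons hred) hmove
    refine ⟨w', h1, ?_, by simp at h3; omega⟩
    rw [h2, List.getLast_cons (a := p) (by simp)]

end Automaton

lemma Recurrent.exists_labelling {P : Q → Prop} (h : T.Recurrent P) :
    ∃ f, T.Labelling f ∧ {h | P (f h)}.Infinite := by
  classical
  obtain ⟨next, hnext⟩ := exists_next_fun T
  obtain ⟨p, q, t, hpq, hqp, hP, ht⟩ := h
  obtain ⟨l, hl, hlast⟩ := List.exists_isChain_cons_of_relationReflTransGen hqp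
  obtain ⟨l₂, hl₂, hlast₂, hhead⟩ : ∃ l₂, List.IsChain T.Step (p :: l₂) ∧
      (p :: l₂).getLast (by simp) = t ∧ ∀ r ∈ l₂.head?, r.2 ≠ q.2 := by
    rcases ht with rfl | ⟨r, hpr, hrq, hrt⟩
    · exact ⟨[], by simp, by simp, by simp⟩
    · obtain ⟨l', hl', hlast'⟩ := List.exists_isChain_cons_of_relationReflTransGen hrt
      exact ⟨r :: l', by simp [hpr, hl'], by rw [List.getLast_cons (by simp), hlast'],
        by simpa using hrq⟩
  set d₀ : Q × List (Q × (α × Bool)) × List (Q × (α × Bool)) := (p.1, q :: l, l₂)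
  have hlab := labelling_of_automaton (T := T) Prod.fst (T.move next d₀) (fun d => T.Live d.1) d₀
    hpq.1 (fun e d hd => (move_spec hnext e d hd).1) (fun d hd => hd.v)
    (fun e d hd => (move_spec hnext e d hd).2)
  refine ⟨_, hlab, ?_⟩
  -- The automaton is in its initial state at reduced words of arbitrary length.
  have hray : ∀ k, ∃ w, FollowableBy w p.2 ∧ w.foldr (T.move next d₀) d₀ = d₀ ∧ k ≤ w.length := by
    intro k
    induction k with
    | zero => exact ⟨[], followableBy_nil _, rfl, le_rfl⟩
    | succ k ih =>
      obtain ⟨w, h1, h2, h3⟩ := ih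
      obtain ⟨w', h1', h2', h3'⟩ := exists_word_of_cycle (T := T) (next := next) (d₀ := d₀)
        (a := p.2) (q :: l) p l₂ w (by simp) (by simp [hpq, hl])
        (fun h => by rw [hlast]) h1 h2
      exact ⟨w', h1', h2', by omega⟩
  have hlong : ∀ k, ∃ h : FreeGroup α, P ((h.toWord.foldr (T.move next d₀) d₀).1) ∧
      k ≤ h.toWord.length := by
    intro k
    obtain ⟨w, h1, h2, h3⟩ := hray k
    obtain ⟨w', h1', h2', h3'⟩ := exists_word_of_excursion (T := T) (next := next) (d₀ := d₀)
      l₂ p (q :: l) w hl₂ (by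
        intro r hr q' hq'
        simp only [List.head?_cons, Option.mem_def, Option.some.injEq] at hq'
        subst hq'
        exact hhead r hr) h1 h2
    refine ⟨FreeGroup.mk w', ?_, ?_⟩
    · rw [FreeGroup.toWord_mk, h1'.reduce_eq, h2', hlast₂]
      exact hP
    · rw [FreeGroup.toWord_mk, h1'.reduce_eq]
      omega
  intro hfin
  obtain ⟨B, hB⟩ := (hfin.image (fun h => h.toWord.length)).bddAbove
  obtain ⟨h, h1, h2⟩ := hlong (B + 1)
  have := hB ⟨h, h1, rfl⟩
  simp only at this
  omega

/-- Along the reduced words that end in `a :: u`, a labelling performs steps. -/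
lemma Labelling.reflTransGen_step {f : FreeGroup α → Q} (hf : T.Labelling f) (a : α × Bool)
    (u s : List (α × Bool)) (h : FreeGroup.IsReduced (s ++ a :: u)) :
    ∃ c v, s ++ a :: u = c :: v ∧ Relation.ReflTransGen T.Step
      (f (FreeGroup.mk (a :: u)), a) (f (FreeGroup.mk (c :: v)), c) := by
  induction s with
  | nil => exact ⟨a, u, rfl, .refl⟩
  | cons b s ih =>
    obtain ⟨c, v, hcv, hr⟩ := ih (h.infix (List.suffix_cons b _).isInfix)
    refine ⟨b, c :: v, by rw [List.cons_append, hcv], hr.tail ?_⟩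
    rw [List.cons_append, hcv, FreeGroup.isReduced_cons_cons] at h
    refine ⟨hf.live _, hf.live _, ?_, hf.2 (FreeGroup.mk (c :: v)) b⟩
    intro hb
    change b = (c.1, !c.2) at hb
    have := h.1 (by rw [hb])
    rw [hb] at this
    simp at this

/-- If infinitely many words ending in `w` are marked, then so are infinitely many words ending in
some `e :: w`. -/
lemma exists_infinite_cons [DecidableEq α] [Finite α] {M : Set (FreeGroup α)}
    {w : List (α × Bool)} (h : {h ∈ M | w <:+ h.toWord}.Infinite) :
    ∃ e, {h ∈ M | e :: w <:+ h.toWord}.Infinite := by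
  by_contra! hfin
  refine (((Set.finite_singleton (FreeGroup.mk w)).union (Set.finite_iUnion
    fun e => hfin e)).subset ?_).not_infinite h
  rintro g ⟨hg, s, hs⟩
  rcases List.eq_nil_or_concat s with rfl | ⟨s, a, rfl⟩
  · left
    rw [Set.mem_singleton_iff, ← FreeGroup.mk_toWord (x := g), ← hs, List.nil_append]
  · right
    exact Set.mem_iUnion.2 ⟨a, hg, s, by simpa using hs⟩

/-- By König's lemma there is a ray such that infinitely many marked vertices lie behind each of its
vertices. It passes twice through the same label with the same letter, and a marked vertex lies
behind the first passage and not behind the second. -/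
lemma Labelling.recurrent [Finite α] {P : Q → Prop} (hV : {σ | T.V σ}.Finite)
    {f : FreeGroup α → Q} (hf : T.Labelling f) (hP : {h | P (f h)}.Infinite) :
    T.Recurrent P := by
  classical
  let N (w : List (α × Bool)) : Set (FreeGroup α) := {h ∈ {h | P (f h)} | w <:+ h.toWord}
  have hN₀ : (N []).Infinite := by simpa [N] using hP
  obtain ⟨ray, e, hnil, hray, hinf⟩ : ∃ (ray : ℕ → List (α × Bool)) (e : ℕ → α × Bool),
      ray 0 = [] ∧ (∀ n, ray (n + 1) = e n :: ray n) ∧ ∀ n, (N (ray n)).Infinite := by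
    choose ext hext using fun w : {w // (N w).Infinite} => exists_infinite_cons w.2
    let ray : ℕ → {w // (N w).Infinite} :=
      fun n => Nat.rec ⟨[], hN₀⟩ (fun _ w => ⟨ext w :: w.1, hext w⟩) n
    exact ⟨fun n => (ray n).1, fun n => ext (ray n), rfl, fun _ => rfl, fun n => (ray n).2⟩
  have hlen : ∀ n, (ray n).length = n := by
    intro n
    induction n with
    | zero => rw [hnil, List.length_nil]
    | succ n ih => rw [hray, List.length_cons, ih]
  have hred : ∀ n, FreeGroup.IsReduced (ray n) := by
    intro n
    obtain ⟨h, hh⟩ := (hinf n).nonempty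
    exact FreeGroup.isReduced_toWord.infix hh.2.isInfix
  have hedge : ∀ n a, FreeGroup.mk [a] * FreeGroup.mk (ray n) = FreeGroup.mk (a :: ray n) :=
    fun n a => FreeGroup.mul_mk
  let p : ℕ → Q × (α × Bool) := fun n => (f (FreeGroup.mk (ray (n + 1))), e n)
  have hp : ∀ n, T.Step (p n) (p (n + 1)) := by
    intro n
    have h2 := hred (n + 2)
    rw [hray (n + 1), hray n, FreeGroup.isReduced_cons_cons] at h2
    refine ⟨hf.live _, hf.live _, ?_, ?_⟩
    swap
    · have h := hf.2 (FreeGroup.mk (ray (n + 1))) (e (n + 1))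
      rw [hedge, ← hray] at h
      exact h
    intro hb
    change e (n + 1) = ((e n).1, !(e n).2) at hb
    have := h2.1 (by rw [hb])
    rw [hb] at this
    simp at this
  have hreach : ∀ {i j}, i ≤ j → Relation.ReflTransGen T.Step (p i) (p j) := by
    intro i j hij
    induction j, hij using Nat.le_induction with
    | base => exact .refl
    | succ j _ ih => exact ih.tail (hp j)
  have : Finite {σ | T.V σ} := hV
  obtain ⟨y, hy⟩ := Finite.exists_infinite_fiber
    (fun n => ((⟨(p n).1, hf.1 _⟩, (p n).2) : {σ | T.V σ} × (α × Bool)))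
  rw [Set.infinite_coe_iff] at hy
  obtain ⟨i, hi⟩ := hy.nonempty
  obtain ⟨t, ht, hti⟩ := (hinf (i + 1)).nonempty
  obtain ⟨j, hj, hij⟩ := hy.exists_gt (max i t.toWord.length)
  have hpij : p j = p i := by
    have := (Set.mem_singleton_iff.1 hj).trans (Set.mem_singleton_iff.1 hi).symm
    simp only [Prod.mk.injEq, Subtype.mk.injEq] at this
    exact Prod.ext this.1 this.2
  -- `k` is the last passage behind which `t` lies.
  obtain ⟨k, hik, hkj, hk, hk'⟩ : ∃ k, i ≤ k ∧ k < j ∧ (ray (k + 1)) <:+ t.toWord ∧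
      ¬ (ray (k + 2)) <:+ t.toWord := by
    by_contra! hcon
    have hall : ∀ k, i ≤ k → k ≤ j → (ray (k + 1)) <:+ t.toWord := by
      intro k hk
      induction k, hk using Nat.le_induction with
      | base => exact fun _ => hti
      | succ k hk ih => exact fun h => hcon k hk (by omega) (ih (by omega))
    have h1 := (hall j (by omega) le_rfl).length_le
    rw [hlen] at h1
    omega
  obtain ⟨s, hs⟩ := hk
  have hcycle : Relation.ReflTransGen T.Step (p (k + 1)) (p k) := by
    have h1 := hreach (i := k + 1) (j := j) hkj
    rw [hpij] at h1
    exact h1.trans (hreach hik)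
  rcases List.eq_nil_or_concat s with rfl | ⟨s, a, rfl⟩
  · refine ⟨p k, p (k + 1), p k, hp k, hcycle, ?_, Or.inl rfl⟩
    change P (f (FreeGroup.mk (ray (k + 1))))
    rw [show (ray (k + 1)) = t.toWord from hs, FreeGroup.mk_toWord]
    exact ht
  · have hs' : s ++ a :: e k :: (ray k) = t.toWord := by
      rw [← hs, hray]
      simp
    have hredt : FreeGroup.IsReduced (s ++ a :: e k :: (ray k)) := by
      rw [hs']
      exact FreeGroup.isReduced_toWord
    obtain ⟨c, v, hcv, hr⟩ := hf.reflTransGen_step a _ s hredt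
    have hredk : FreeGroup.IsReduced (a :: e k :: (ray k)) :=
      hredt.infix (List.suffix_append s _).isInfix
    refine ⟨p k, p (k + 1), _, hp k, hcycle, ?_, Or.inr ⟨_, ?_, ?_, hr⟩⟩
    · rw [← hcv, hs', FreeGroup.mk_toWord]
      exact ht
    · refine ⟨hf.live _, hf.live _, ?_, ?_⟩
      swap
      · have h := hf.2 (FreeGroup.mk (ray (k + 1))) a
        rw [hedge] at h
        change T.R a (f (FreeGroup.mk (ray (k + 1)))) (f (FreeGroup.mk (a :: e k :: ray k)))
        rwa [← hray k]
      rw [FreeGroup.isReduced_cons_cons] at hredk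
      intro hb
      change a = ((e k).1, !(e k).2) at hb
      have := hredk.1 (by rw [hb])
      rw [hb] at this
      simp at this
    · intro hae
      change a = e (k + 1) at hae
      exact hk' ⟨s, by rw [hray (k + 1), hray k, ← hae, hs']⟩

theorem exists_labelling_infinite_iff [Finite α] (hV : {σ | T.V σ}.Finite) (P : Q → Prop) :
    (∃ f, T.Labelling f ∧ {h | P (f h)}.Infinite) ↔ T.Recurrent P :=
  ⟨fun ⟨_, hf, hP⟩ => hf.recurrent hV hP, Recurrent.exists_labelling⟩

end TreeRules

/-! ### Bounded quantifiers -/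

section Primrec

variable {α β : Type*} [Primcodable α] [Primcodable β]

/-- Bounded quantification over codes of elements of a type. -/
lemma PrimrecPred.exists_encode_lt {p : α → β → Prop} {N : α → ℕ}
    (hp : PrimrecPred fun x : α × β => p x.1 x.2) (hN : Primrec N) :
    PrimrecPred fun a => ∃ b, Encodable.encode b < N a ∧ p a b := by
  classical
  -- A code below the bound may be decoded to an element whose own code is different.
  have hp' : PrimrecRel fun (n : ℕ) (x : α) => ∃ b ∈ Encodable.decode₂ β n, p x b := by
    have h : Primrec fun x : ℕ × α =>
        Option.casesOn (motive := fun _ => Bool) (Encodable.decode₂ β x.1) false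
          (fun b => decide (p x.2 b)) :=
      Primrec.option_casesOn (Primrec.decode₂.comp .fst) (.const false)
        ((hp.comp ((Primrec.snd.comp .fst).pair .snd)).decide)
    refine PrimrecPred.of_eq (Primrec.eq.comp h (.const true)) fun x => ?_
    cases hx : Encodable.decode₂ β x.1 <;> simp [hx]
  refine (hp'.exists_mem_list.comp (Primrec.list_range.comp hN) .id).of_eq fun a => ?_
  simp only [List.mem_range, Encodable.mem_decode₂, id]
  constructor
  · rintro ⟨_, h, b, rfl, hb⟩
    exact ⟨b, h, hb⟩
  · rintro ⟨b, h, hb⟩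
    exact ⟨_, h, b, rfl, hb⟩

lemma PrimrecPred.forall_encode_lt {p : α → β → Prop} {N : α → ℕ}
    (hp : PrimrecPred fun x : α × β => p x.1 x.2) (hN : Primrec N) :
    PrimrecPred fun a => ∀ b, Encodable.encode b < N a → p a b :=
  (PrimrecPred.exists_encode_lt (p := fun a b => ¬ p a b) hp.not hN).not.of_eq fun a => by
    push Not
    rfl

lemma PrimrecPred.exists_lt_of_primrec {p : α → ℕ → Prop} {N : α → ℕ}
    (hp : PrimrecPred fun x : α × ℕ => p x.1 x.2) (hN : Primrec N) :
    PrimrecPred fun a => ∃ n < N a, p a n :=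
  (PrimrecPred.exists_encode_lt hp hN).of_eq fun _ => by simp

lemma PrimrecPred.forall_lt_of_primrec {p : α → ℕ → Prop} {N : α → ℕ}
    (hp : PrimrecPred fun x : α × ℕ => p x.1 x.2) (hN : Primrec N) :
    PrimrecPred fun a => ∀ n < N a, p a n :=
  (PrimrecPred.forall_encode_lt hp hN).of_eq fun _ => by simp

lemma PrimrecPred.forall_finite {ι : Type*} [Finite ι] {p : ι → α → Prop}
    (hp : ∀ i, PrimrecPred (p i)) : PrimrecPred fun a => ∀ i, p i a := by
  classical
  have := Fintype.ofFinite ι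
  have h : ∀ s : Finset ι, PrimrecPred fun a => ∀ i ∈ s, p i a := by
    intro s
    induction s using Finset.induction_on with
    | empty => exact (Primrec.const true).primrecPred.of_eq (p := fun _ => True) (by simp)
    | insert i s _ ih => exact ((hp i).and ih).of_eq (by simp)
  exact (h Finset.univ).of_eq (by simp)

lemma PrimrecPred.exists_finite {ι : Type*} [Finite ι] {p : ι → α → Prop}
    (hp : ∀ i, PrimrecPred (p i)) : PrimrecPred fun a => ∃ i, p i a :=
  (PrimrecPred.forall_finite fun i => (hp i).not).not.of_eq fun a => by simp

lemma Primrec.nat_pow : Primrec₂ ((· ^ ·) : ℕ → ℕ → ℕ) :=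
  Primrec₂.unpaired'.1 Nat.Primrec.pow

end Primrec

/-! ### Functions and sets coded by the digits of a number -/

/-- The `i`-th digit of `c` in base `n`. -/
def digit (n c i : ℕ) : ℕ := c / n ^ i % n

lemma digit_lt {n : ℕ} (hn : 0 < n) (c i : ℕ) : digit n c i < n := Nat.mod_lt _ hn

/-- Every function on `Fin k` with values below `n` is given by the base `n` digits of a number. -/
lemma exists_digit_eq {n k : ℕ} (g : Fin k → Fin n) :
    ∃ c < n ^ k, ∀ i : Fin k, digit n c i = g i := by
  refine ⟨finFunctionFinEquiv g, (finFunctionFinEquiv g).2, fun i => ?_⟩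
  have h := congrFun (finFunctionFinEquiv.symm_apply_apply g) i
  exact congrArg Fin.val h

/-- Every set of numbers below `N` is given by the binary digits of a number. -/
lemma exists_digit_two_iff (N : ℕ) (S : Set ℕ) :
    ∃ c < 2 ^ N, ∀ i < N, digit 2 c i = 1 ↔ i ∈ S := by
  classical
  obtain ⟨c, hc, h⟩ := exists_digit_eq (n := 2) (k := N) (fun i => if (i : ℕ) ∈ S then 1 else 0)
  refine ⟨c, hc, fun i hi => ?_⟩
  rw [h ⟨i, hi⟩]
  by_cases hS : i ∈ S <;> simp [hS]

lemma Primrec.digit {α : Type*} [Primcodable α] {n c i : α → ℕ} (hn : Primrec n) (hc : Primrec c)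
    (hi : Primrec i) : Primrec fun a => digit (n a) (c a) (i a) :=
  Primrec.nat_mod.comp (Primrec.nat_div.comp hc (Primrec.nat_pow.comp hn hi)) hn

/-! ### Reachability and live labels are primitive recursive -/

open Relation in
/-- Reachability for a primitive recursive relation on a bounded set is primitive recursive: the
targets are the elements of all sets that contain the source and are closed under the relation, and
these sets can be enumerated. -/
lemma PrimrecPred.reflTransGen {α β : Type*} [Primcodable α] [Primcodable β]
    {r : α → β → β → Prop} {N : α → ℕ} (hN : Primrec N)
    (hr : PrimrecPred fun x : α × β × β => r x.1 x.2.1 x.2.2)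
    (hrN : ∀ a x y, r a x y → Encodable.encode y < N a) :
    PrimrecPred fun x : α × β × β =>
      Encodable.encode x.2.1 < N x.1 ∧ ReflTransGen (r x.1) x.2.1 x.2.2 := by
  have hbit {γ : Type _} [Primcodable γ] {c i : γ → ℕ} (hc : Primrec c) (hi : Primrec i) :
      PrimrecPred fun a => digit 2 (c a) (i a) = 1 :=
    Primrec.eq.comp (Primrec.digit (.const 2) hc hi) (.const 1)
  have hclosed : PrimrecPred fun x : α × ℕ =>
      ∀ u : β, Encodable.encode u < N x.1 → ∀ v : β, Encodable.encode v < N x.1 →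
        (¬ r x.1 u v ∨ ¬ digit 2 x.2 (Encodable.encode u) = 1) ∨
          digit 2 x.2 (Encodable.encode v) = 1 := by
    refine PrimrecPred.forall_encode_lt (PrimrecPred.forall_encode_lt ?_
      (hN.comp (Primrec.fst.comp .fst))) (hN.comp .fst)
    have hx : Primrec fun y : ((α × ℕ) × β) × β => y.1.1.2 :=
      Primrec.snd.comp (Primrec.fst.comp .fst)
    have hu : Primrec fun y : ((α × ℕ) × β) × β => y.1.2 := Primrec.snd.comp .fst
    refine ((hr.comp ((Primrec.fst.comp (Primrec.fst.comp .fst)).pair (hu.pair .snd))).not.or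
      (hbit hx (Primrec.encode.comp hu)).not).or (hbit hx (Primrec.encode.comp .snd))
  have hall : PrimrecPred fun x : α × β × β => Encodable.encode x.2.1 < N x.1 ∧
      Encodable.encode x.2.2 < N x.1 ∧ ∀ c < 2 ^ N x.1,
        (¬ digit 2 c (Encodable.encode x.2.1) = 1 ∨
          ¬ ∀ u : β, Encodable.encode u < N x.1 → ∀ v : β, Encodable.encode v < N x.1 →
            (¬ r x.1 u v ∨ ¬ digit 2 c (Encodable.encode u) = 1) ∨
              digit 2 c (Encodable.encode v) = 1) ∨
        digit 2 c (Encodable.encode x.2.2) = 1 := by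
    have hN' : Primrec fun x : α × β × β => N x.1 := hN.comp .fst
    have h1 : Primrec fun x : α × β × β => Encodable.encode x.2.1 :=
      Primrec.encode.comp (Primrec.fst.comp .snd)
    have h2 : Primrec fun x : α × β × β => Encodable.encode x.2.2 :=
      Primrec.encode.comp (Primrec.snd.comp .snd)
    refine (Primrec.nat_lt.comp h1 hN').and ((Primrec.nat_lt.comp h2 hN').and
      (PrimrecPred.forall_lt_of_primrec ?_ (Primrec.nat_pow.comp (.const 2) hN')))
    refine ((hbit .snd (h1.comp .fst)).not.or ?_).or (hbit .snd (h2.comp .fst))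
    exact (hclosed.comp ((Primrec.fst.comp .fst).pair .snd)).not
  refine hall.of_eq fun ⟨a, x, y⟩ => and_congr_right fun hx => ?_
  simp only at hx ⊢
  constructor
  · rintro ⟨hy, h⟩
    obtain ⟨c, hc, hcS⟩ := exists_digit_two_iff (N a)
      (Encodable.encode '' {z | ReflTransGen (r a) x z})
    have hcS' : ∀ z : β, Encodable.encode z < N a →
        (digit 2 c (Encodable.encode z) = 1 ↔ ReflTransGen (r a) x z) := fun z hz => by
      rw [hcS _ hz, Encodable.encode_injective.mem_set_image]
      rfl
    rcases h c hc with (h | h) | h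
    · exact absurd ((hcS' x hx).2 .refl) h
    · refine absurd (fun u hu v hv => ?_) h
      by_cases huv : r a u v
      · by_cases hcu : digit 2 c (Encodable.encode u) = 1
        · exact Or.inr ((hcS' v hv).2 (((hcS' u hu).1 hcu).tail huv))
        · exact Or.inl (Or.inr hcu)
      · exact Or.inl (Or.inl huv)
    · exact (hcS' y hy).1 h
  · intro h
    have hb : ∀ z, ReflTransGen (r a) x z → Encodable.encode z < N a := by
      intro z hz
      rcases hz.cases_tail with rfl | ⟨w, _, hw⟩
      · exact hx
      · exact hrN a w z hw
    refine ⟨hb y h, fun c _ => ?_⟩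
    by_contra! hcon
    obtain ⟨⟨h1, h2⟩, h3⟩ := hcon
    refine h3 ?_
    clear h3
    induction h with
    | refl => exact h1
    | tail hz hzw ih =>
      rcases h2 _ (hb _ hz) _ (hrN a _ _ hzw) with (h | h) | h
      · exact absurd hzw h
      · exact absurd ih h
      · exact h

namespace TreeRules

variable {α : Type*} [Primcodable α] {m : ℕ} {T : α → TreeRules (Fin m) ℕ} {N : α → ℕ}

/-- The rules are given by primitive recursive relations, on labels below a primitive recursive
bound. -/
structure PrimrecFamily (T : α → TreeRules (Fin m) ℕ) (N : α → ℕ) : Prop where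
  bound : Primrec N
  lt_bound : ∀ a σ, (T a).V σ → σ < N a
  vertex : PrimrecPred fun x : α × ℕ => (T x.1).V x.2
  edge : ∀ e, PrimrecPred fun x : α × ℕ × ℕ => (T x.1).R e x.2.1 x.2.2

namespace PrimrecFamily

variable (hT : PrimrecFamily T N)
include hT

lemma live : PrimrecPred fun x : α × ℕ => (T x.1).Live x.2 := by
  have hbit {γ : Type _} [Primcodable γ] {c i : γ → ℕ} (hc : Primrec c) (hi : Primrec i) :
      PrimrecPred fun a => digit 2 (c a) (i a) = 1 :=
    Primrec.eq.comp (Primrec.digit (.const 2) hc hi) (.const 1)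
  have hedge : ∀ e, PrimrecPred fun x : ((α × ℕ) × ℕ) × ℕ => (T x.1.1.1).R e x.1.2 x.2 :=
    fun e => (hT.edge e).comp ((Primrec.fst.comp (Primrec.fst.comp .fst)).pair
      ((Primrec.snd.comp .fst).pair .snd))
  have hgood : PrimrecPred fun x : α × ℕ => ∀ τ < N x.1, ¬ digit 2 x.2 τ = 1 ∨
      ((T x.1).V τ ∧ ∀ e, ∃ υ < N x.1, digit 2 x.2 υ = 1 ∧ (T x.1).R e τ υ) := by
    refine PrimrecPred.forall_lt_of_primrec ((hbit (Primrec.snd.comp .fst) .snd).not.or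
      ((hT.vertex.comp ((Primrec.fst.comp .fst).pair .snd)).and (PrimrecPred.forall_finite fun e =>
        PrimrecPred.exists_lt_of_primrec ((hbit (Primrec.snd.comp (Primrec.fst.comp .fst)) .snd).and
          (hedge e)) (hT.bound.comp (Primrec.fst.comp .fst))))) (hT.bound.comp .fst)
  have hall : PrimrecPred fun x : α × ℕ => x.2 < N x.1 ∧ ∃ c < 2 ^ N x.1, digit 2 c x.2 = 1 ∧
      ∀ τ < N x.1, ¬ digit 2 c τ = 1 ∨
        ((T x.1).V τ ∧ ∀ e, ∃ υ < N x.1, digit 2 c υ = 1 ∧ (T x.1).R e τ υ) :=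
    (Primrec.nat_lt.comp .snd (hT.bound.comp .fst)).and (PrimrecPred.exists_lt_of_primrec
      ((hbit .snd (Primrec.snd.comp .fst)).and
        (hgood.comp ((Primrec.fst.comp .fst).pair .snd)))
      (Primrec.nat_pow.comp (.const 2) (hT.bound.comp .fst)))
  refine hall.of_eq fun ⟨a, σ⟩ => ?_
  simp only
  constructor
  · rintro ⟨hσ, c, _, hcσ, h⟩
    refine ⟨{τ | τ < N a ∧ digit 2 c τ = 1}, ⟨hσ, hcσ⟩, fun τ hτ => ?_⟩
    obtain ⟨hV, hR⟩ := (h τ hτ.1).resolve_left (not_not_intro hτ.2)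
    refine ⟨hV, fun e => ?_⟩
    obtain ⟨υ, hυ, hcυ, hR⟩ := hR e
    exact ⟨υ, ⟨hυ, hcυ⟩, hR⟩
  · rintro ⟨S, hσ, hS⟩
    have hlt : ∀ τ ∈ S, τ < N a := fun τ hτ => hT.lt_bound a τ (hS τ hτ).1
    obtain ⟨c, hc, hcS⟩ := exists_digit_two_iff (N a) S
    refine ⟨hlt σ hσ, c, hc, (hcS σ (hlt σ hσ)).2 hσ, fun τ hτ => ?_⟩
    by_cases hcτ : digit 2 c τ = 1
    · obtain ⟨hV, hR⟩ := hS τ ((hcS τ hτ).1 hcτ)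
      refine Or.inr ⟨hV, fun e => ?_⟩
      obtain ⟨υ, hυ, hR⟩ := hR e
      exact ⟨υ, hlt υ hυ, (hcS υ (hlt υ hυ)).2 hυ, hR⟩
    · exact Or.inl hcτ

lemma exists_live {P : α → ℕ → Prop} (hP : PrimrecPred fun x : α × ℕ => P x.1 x.2) :
    PrimrecPred fun a => ∃ σ, (T a).Live σ ∧ P a σ :=
  (PrimrecPred.exists_lt_of_primrec (p := fun a σ => (T a).Live σ ∧ P a σ) (hT.live.and hP)
    hT.bound).of_eq fun a =>
      ⟨fun ⟨σ, _, h⟩ => ⟨σ, h⟩, fun ⟨σ, h⟩ => ⟨σ, hT.lt_bound a σ h.1.v, h⟩⟩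

lemma step : PrimrecPred fun x : α × (ℕ × (Fin m × Bool)) × (ℕ × (Fin m × Bool)) =>
    (T x.1).Step x.2.1 x.2.2 := by
  have h1 : Primrec fun x : α × (ℕ × (Fin m × Bool)) × (ℕ × (Fin m × Bool)) => x.2.1 :=
    Primrec.fst.comp .snd
  have h2 : Primrec fun x : α × (ℕ × (Fin m × Bool)) × (ℕ × (Fin m × Bool)) => x.2.2 :=
    Primrec.snd.comp .snd
  have hinv : Primrec fun e : Fin m × Bool => (e.1, !e.2) := Primrec.dom_finite _
  have hR : PrimrecPred fun x : α × (ℕ × (Fin m × Bool)) × (ℕ × (Fin m × Bool)) =>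
      ∃ e, x.2.2.2 = e ∧ (T x.1).R e x.2.1.1 x.2.2.1 :=
    PrimrecPred.exists_finite fun e => (Primrec.eq.comp (Primrec.snd.comp h2) (.const e)).and
      ((hT.edge e).comp (Primrec.fst.pair ((Primrec.fst.comp h1).pair (Primrec.fst.comp h2))))
  exact ((hT.live.comp (Primrec.fst.pair (Primrec.fst.comp h1))).and
    ((hT.live.comp (Primrec.fst.pair (Primrec.fst.comp h2))).and
      ((Primrec.eq.comp (Primrec.snd.comp h2) (hinv.comp (Primrec.snd.comp h1))).not.and
        hR))).of_eq fun x => by simp [Step]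

lemma recurrent {P : α → ℕ → Prop} (hP : PrimrecPred fun x : α × ℕ => P x.1 x.2) :
    PrimrecPred fun a => (T a).Recurrent (P a) := by
  obtain ⟨C, hC⟩ := (Set.finite_range (Encodable.encode : Fin m × Bool → ℕ)).bddAbove
  let B : α → ℕ := fun a => (N a + C + 1) ^ 2
  have hB : Primrec B := Primrec.nat_pow.comp
    (Primrec.succ.comp (Primrec.nat_add.comp hT.bound (.const C))) (.const 2)
  have hlt : ∀ a (p : ℕ × (Fin m × Bool)), (T a).Live p.1 → Encodable.encode p < B a := by
    rintro a ⟨σ, e⟩ hp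
    have h1 := hT.lt_bound a σ hp.v
    have h2 : Encodable.encode e ≤ C := hC ⟨e, rfl⟩
    rw [Encodable.encode_prod_val]
    refine (Nat.pair_lt_max_add_one_sq _ _).trans_le (Nat.pow_le_pow_left ?_ 2)
    simp only [Encodable.encode_nat]
    omega
  have hreach := PrimrecPred.reflTransGen (r := fun a => (T a).Step) hB hT.step
    (fun a x y h => hlt a y h.2.1)
  have hall : PrimrecPred fun a => ∃ p : ℕ × (Fin m × Bool), Encodable.encode p < B a ∧
      ∃ q : ℕ × (Fin m × Bool), Encodable.encode q < B a ∧
      ∃ t : ℕ × (Fin m × Bool), Encodable.encode t < B a ∧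
        (T a).Step p q ∧ (Encodable.encode q < B a ∧ Relation.ReflTransGen (T a).Step q p) ∧
        P a t.1 ∧ (t = p ∨ ∃ r : ℕ × (Fin m × Bool), Encodable.encode r < B a ∧ (T a).Step p r ∧
          ¬ r.2 = q.2 ∧ (Encodable.encode r < B a ∧ Relation.ReflTransGen (T a).Step r t)) := by
    refine PrimrecPred.exists_encode_lt (PrimrecPred.exists_encode_lt (PrimrecPred.exists_encode_lt
      ?_ (hB.comp (Primrec.fst.comp .fst))) (hB.comp .fst)) hB
    have ha : Primrec fun x : ((α × (ℕ × (Fin m × Bool))) × (ℕ × (Fin m × Bool))) ×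
      (ℕ × (Fin m × Bool)) => x.1.1.1 := Primrec.fst.comp (Primrec.fst.comp .fst)
    have hp : Primrec fun x : ((α × (ℕ × (Fin m × Bool))) × (ℕ × (Fin m × Bool))) ×
      (ℕ × (Fin m × Bool)) => x.1.1.2 := Primrec.snd.comp (Primrec.fst.comp .fst)
    have hq : Primrec fun x : ((α × (ℕ × (Fin m × Bool))) × (ℕ × (Fin m × Bool))) ×
      (ℕ × (Fin m × Bool)) => x.1.2 := Primrec.snd.comp .fst
    refine (hT.step.comp (ha.pair (hp.pair hq))).and ((hreach.comp (ha.pair (hq.pair hp))).and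
      ((hP.comp (ha.pair (Primrec.fst.comp .snd))).and ((Primrec.eq.comp .snd hp).or
        (PrimrecPred.exists_encode_lt ?_ (hB.comp ha)))))
    exact (hT.step.comp ((ha.comp .fst).pair ((hp.comp .fst).pair .snd))).and
      ((Primrec.eq.comp (Primrec.snd.comp .snd) (Primrec.snd.comp (hq.comp .fst))).not.and
        (hreach.comp ((ha.comp .fst).pair (Primrec.snd.pair (Primrec.snd.comp .fst)))))
  refine hall.of_eq fun a => ?_
  constructor
  · rintro ⟨p, _, q, _, t, _, h1, ⟨_, h2⟩, h3, h4⟩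
    refine ⟨p, q, t, h1, h2, h3, h4.imp_right ?_⟩
    rintro ⟨r, _, h5, h6, _, h7⟩
    exact ⟨r, h5, h6, h7⟩
  · rintro ⟨p, q, t, h1, h2, h3, h4⟩
    have ht : (T a).Live t.1 := by
      rcases h4 with rfl | ⟨r, h5, _, h7⟩
      · exact h1.1
      · rcases h7.cases_tail with rfl | ⟨w, _, hw⟩
        · exact h5.2.1
        · exact hw.2.1
    refine ⟨p, hlt a p h1.1, q, hlt a q h1.2.1, t, hlt a t ht, h1, ⟨hlt a q h1.2.1, h2⟩, h3,
      h4.imp_right ?_⟩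
    rintro ⟨r, h5, h6, h7⟩
    exact ⟨r, hlt a r h5.2.1, h5, h6, hlt a r h5.2.1, h7⟩

end PrimrecFamily

end TreeRules

/-! ### Bags of letters around the cosets of a free subgroup of finite index -/

/-- A free group that is finitely generated has finitely many free generators: a generator outside
the letters of a finite generating set would be killed by a homomorphism that it survives. -/
lemma finite_of_fg_freeGroup {X : Type*} [hfg : Group.FG (FreeGroup X)] : Finite X := by
  classical
  obtain ⟨S, hS⟩ := hfg.out
  let Y : Set X := ⋃ g ∈ S, {a | a ∈ g.toWord.map Prod.fst}
  have hY : Y.Finite := S.finite_toSet.biUnion fun g _ => List.finite_toSet _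
  have hYuniv : Y = Set.univ := by
    refine Set.eq_univ_of_forall fun a => by_contra fun ha => ?_
    let ψ : FreeGroup X →* Multiplicative ℤ :=
      FreeGroup.lift fun b => if b = a then Multiplicative.ofAdd 1 else 1
    have hψ : ψ = 1 := by
      refine MonoidHom.eq_of_eqOn_dense hS fun g hg => ?_
      have hw : ∀ w : List (X × Bool), (∀ b ∈ w.map Prod.fst, b ≠ a) →
          ψ (FreeGroup.mk w) = 1 := by
        intro w hw
        rw [FreeGroup.lift_mk]
        refine List.prod_eq_one fun z hz => ?_
        obtain ⟨⟨b, c⟩, hb, rfl⟩ := List.mem_map.1 hz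
        have : b ≠ a := hw b (List.mem_map.2 ⟨_, hb, rfl⟩)
        cases c <;> simp [this]
      rw [← FreeGroup.mk_toWord (x := g)]
      refine hw _ fun b hb hba => ha ?_
      exact Set.mem_biUnion hg (hba ▸ hb)
    have h1 := DFunLike.congr_fun hψ (FreeGroup.of a)
    simp [ψ] at h1
  exact Set.finite_univ_iff.1 (hYuniv ▸ hY)

/-- A finitely generated virtually free group is parametrised by a free group of finite rank and
finitely many coset representatives. -/
lemma VirtuallyFree.exists_parametrization {G : Type*} [Group G] [Group.FG G]
    (hG : VirtuallyFree G) :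
    ∃ (m k : ℕ) (φ : FreeGroup (Fin m) →* G) (τ : Fin k → G),
      Function.Bijective fun p : FreeGroup (Fin m) × Fin k => (φ p.1)⁻¹ * τ p.2 := by
  obtain ⟨H, hH, hfree⟩ := hG
  have : Group.FG (FreeGroup (IsFreeGroup.Generators H)) :=
    Group.fg_of_surjective (f := (IsFreeGroup.toFreeGroup H).toMonoidHom)
      (IsFreeGroup.toFreeGroup H).surjective
  have : Finite (IsFreeGroup.Generators H) := finite_of_fg_freeGroup
  let ψ : FreeGroup (Fin (Nat.card (IsFreeGroup.Generators H))) ≃* H :=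
    (FreeGroup.freeGroupCongr (Finite.equivFin _).symm).trans (IsFreeGroup.toFreeGroup H).symm
  obtain ⟨S, hS, -⟩ := H.exists_isComplement_right 1
  have : Finite S := hS.finite_right_iff.2 hH
  refine ⟨_, Nat.card S, H.subtype.comp ψ.toMonoidHom, fun t => ((Finite.equivFin S).symm t : G), ?_⟩
  let E : FreeGroup (Fin (Nat.card (IsFreeGroup.Generators H))) × Fin (Nat.card S) ≃ H × S :=
    Equiv.prodCongr ((Equiv.inv _).trans ψ.toEquiv) (Finite.equivFin S).symm
  have hE : Function.Bijective fun p => hS.equiv.symm (E p) :=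
    hS.equiv.symm.bijective.comp E.bijective
  convert hE using 2 with p
  rw [hS.equiv_symm_apply]
  change (ψ p.1 : G)⁻¹ * _ = ((ψ p.1⁻¹ : H) : G) * _
  rw [map_inv, Subgroup.coe_inv]
  rfl

section Bags

variable {m k d L : ℕ}

/-- The sites of a bag: words of length at most `L` in the generators and their inverses, and coset
representatives. The bag at `h` carries at `(w, t)` the letter of the coset representative `t` at
the vertex `w * h`. Words need not be reduced. -/
abbrev BagSite (m k L : ℕ) : Type := {w : List (Fin m × Bool) // w.length ≤ L} × Fin k

instance : Finite {w : List (Fin m × Bool) // w.length ≤ L} :=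
  (List.finite_length_le (Fin m × Bool) L).to_subtype

instance : Finite {w : List (Fin m × Bool) // w.length < L} :=
  (List.finite_length_lt (Fin m × Bool) L).to_subtype

/-- The letter at a site of the bag with code `σ` over an alphabet of `n` letters. -/
noncomputable def bagLetter (n σ : ℕ) (j : BagSite m k L) : ℕ :=
  digit n σ (Finite.equivFin (BagSite m k L) j)

lemma exists_bagLetter_eq {n : ℕ} (y : BagSite m k L → Fin n) :
    ∃ σ < n ^ Nat.card (BagSite m k L), ∀ j : BagSite m k L, bagLetter n σ j = y j := by
  obtain ⟨σ, hσ, h⟩ := exists_digit_eq (y ∘ (Finite.equivFin (BagSite m k L)).symm)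
  exact ⟨σ, hσ, fun j => by simp [bagLetter, h]⟩

/-- The empty word, that is, the central vertex of a bag. -/
abbrev emptySite : {w : List (Fin m × Bool) // w.length ≤ L} := ⟨[], Nat.zero_le _⟩

/-- The rules for bags of letters. The product of the coset representative `t` with the `i`-th
generator is the coset representative `t' t i` at the vertex `c t i`. A bag is allowed if it
displays no forbidden pattern at its central vertex, and bags at neighbouring vertices have to agree
wherever they overlap. -/
def bagRules (c : Fin k → Fin d → {w : List (Fin m × Bool) // w.length ≤ L})
    (t' : Fin k → Fin d → Fin k) (I : DominoInput d) : TreeRules (Fin m) ℕ where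
  V σ := σ < I.1 ^ Nat.card (BagSite m k L) ∧
    ∀ t i, (bagLetter I.1 σ ((emptySite, t) : BagSite m k L),
      bagLetter I.1 σ ((c t i, t' t i) : BagSite m k L), i) ∉ I.2.1
  R e σ τ := (∀ (w : {w : List (Fin m × Bool) // w.length < L}) (t : Fin k),
      bagLetter I.1 τ ((⟨w, w.2.le⟩, t) : BagSite m k L) =
        bagLetter I.1 σ ((⟨w ++ [e], by simpa using w.2⟩, t) : BagSite m k L)) ∧
    ∀ (w : {w : List (Fin m × Bool) // w.length < L}) (t : Fin k),
      bagLetter I.1 σ ((⟨w, w.2.le⟩, t) : BagSite m k L) =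
        bagLetter I.1 τ ((⟨w ++ [(e.1, !e.2)], by simpa using w.2⟩, t) : BagSite m k L)
  symm e σ τ h := ⟨h.2, by simpa using h.1⟩

/-- The bags that display the target letter at their central vertex. -/
def BagTarget (m k L : ℕ) {d : ℕ} (I : DominoInput d) (σ : ℕ) : Prop :=
  I.2.2 < I.1 ∧ ∃ t, bagLetter I.1 σ ((emptySite, t) : BagSite m k L) = I.2.2

variable {c : Fin k → Fin d → {w : List (Fin m × Bool) // w.length ≤ L}}
  {t' : Fin k → Fin d → Fin k}

lemma Primrec.bagLetter {α : Type*} [Primcodable α] {n σ : α → ℕ} (hn : Primrec n)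
    (hσ : Primrec σ) (j : BagSite m k L) : Primrec fun a => bagLetter (n a) (σ a) j :=
  Primrec.digit hn hσ (.const _)

lemma primrecFamily_bagRules :
    TreeRules.PrimrecFamily (bagRules c t') fun I => I.1 ^ Nat.card (BagSite m k L) where
  bound := Primrec.nat_pow.comp .fst (.const _)
  lt_bound _ _ h := h.1
  vertex := by
    have hn : Primrec fun x : DominoInput d × ℕ => x.1.1 := Primrec.fst.comp .fst
    refine (Primrec.nat_lt.comp .snd (Primrec.nat_pow.comp hn (.const _))).and
      (PrimrecPred.forall_finite fun t => PrimrecPred.forall_finite fun i => PrimrecPred.not ?_)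
    have hj (j : BagSite m k L) : Primrec fun x : DominoInput d × ℕ => bagLetter x.1.1 x.2 j :=
      Primrec.bagLetter hn .snd j
    exact ((Primrec.eq.exists_mem_list).comp (Primrec.fst.comp (Primrec.snd.comp .fst))
      ((hj (emptySite, t)).pair ((hj (c t i, t' t i)).pair (.const i)))).of_eq fun x => by simp
  edge e := by
    have hn : Primrec fun x : DominoInput d × ℕ × ℕ => x.1.1 := Primrec.fst.comp .fst
    have h1 : Primrec fun x : DominoInput d × ℕ × ℕ => x.2.1 := Primrec.fst.comp .snd
    have h2 : Primrec fun x : DominoInput d × ℕ × ℕ => x.2.2 := Primrec.snd.comp .snd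
    exact (PrimrecPred.forall_finite fun w => PrimrecPred.forall_finite fun t =>
        Primrec.eq.comp (Primrec.bagLetter hn h2 _) (Primrec.bagLetter hn h1 _)).and
      (PrimrecPred.forall_finite fun w => PrimrecPred.forall_finite fun t =>
        Primrec.eq.comp (Primrec.bagLetter hn h1 _) (Primrec.bagLetter hn h2 _))

lemma primrecPred_bagTarget :
    PrimrecPred fun x : DominoInput d × ℕ => BagTarget m k L x.1 x.2 := by
  have hn : Primrec fun x : DominoInput d × ℕ => x.1.1 := Primrec.fst.comp .fst
  have ha : Primrec fun x : DominoInput d × ℕ => x.1.2.2 :=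
    Primrec.snd.comp (Primrec.snd.comp .fst)
  exact (Primrec.nat_lt.comp ha hn).and (PrimrecPred.exists_finite fun t =>
    Primrec.eq.comp (Primrec.bagLetter hn .snd _) ha)

/-- Since neighbouring bags agree wherever they overlap, a bag displays the letters at the centres
of the surrounding bags. -/
lemma bagLetter_labelling {I : DominoInput d} {f : FreeGroup (Fin m) → ℕ}
    (hf : (bagRules c t' I).Labelling f) (t : Fin k) (w : List (Fin m × Bool)) :
    ∀ (hw : w.length ≤ L) (h : FreeGroup (Fin m)),
      bagLetter I.1 (f h) ((⟨w, hw⟩, t) : BagSite m k L) =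
        bagLetter I.1 (f (FreeGroup.mk w * h)) ((emptySite, t) : BagSite m k L) := by
  induction w using List.reverseRecOn with
  | nil => exact fun _ h => by rw [← FreeGroup.one_eq_mk, one_mul]
  | append_singleton w e ih =>
    intro hw h
    have hw' : w.length < L := by simpa using hw
    rw [← (hf.2 h e).1 ⟨w, hw'⟩ t, ih, ← mul_assoc, FreeGroup.mul_mk]

variable {G : Type*} [Group G] {φ : FreeGroup (Fin m) →* G} {τ : Fin k → G} {s : Fin d → G}

lemma exists_labelling_of_mem_nnSubshift
    (hs : ∀ t i, τ t * s i = (φ (FreeGroup.mk (c t i).1))⁻¹ * τ (t' t i)) {I : DominoInput d}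
    {x : G → Fin I.1} (hx : x ∈ nnSubshift s I.patterns) :
    ∃ f, (bagRules c t' I).Labelling f ∧ ∀ h t,
      bagLetter I.1 (f h) ((emptySite, t) : BagSite m k L) = x ((φ h)⁻¹ * τ t) := by
  choose f hf hfx using fun h : FreeGroup (Fin m) => exists_bagLetter_eq
    (fun j : BagSite m k L => x ((φ (FreeGroup.mk j.1.1 * h))⁻¹ * τ j.2))
  have hcentre : ∀ h t, bagLetter I.1 (f h) ((emptySite, t) : BagSite m k L) =
      x ((φ h)⁻¹ * τ t) := fun h t => by rw [hfx, ← FreeGroup.one_eq_mk, one_mul]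
  refine ⟨f, ⟨fun h => ⟨hf h, fun t i hF => ?_⟩, fun h e => ⟨fun w t => ?_, fun w t => ?_⟩⟩, hcentre⟩
  · rw [hcentre, hfx] at hF
    refine hx _ _ i hF ⟨(φ h)⁻¹ * τ t, rfl, ?_⟩
    rw [mul_assoc, hs, map_mul, mul_inv_rev, mul_assoc]
  · rw [hfx, hfx]
    simp only
    rw [← mul_assoc, FreeGroup.mul_mk]
  · rw [hfx, hfx]
    simp only
    rw [← FreeGroup.mul_mk, mul_assoc, ← mul_assoc (FreeGroup.mk [_]) (FreeGroup.mk [_]) h]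
    have : FreeGroup.mk [(e.1, !e.2)] * FreeGroup.mk [e] = 1 := by
      have := inv_mul_cancel (FreeGroup.mk [e])
      rwa [FreeGroup.inv_mk] at this
    rw [this, one_mul]

lemma exists_mem_nnSubshift_of_labelling
    (hbij : Function.Bijective fun p : FreeGroup (Fin m) × Fin k => (φ p.1)⁻¹ * τ p.2)
    (hs : ∀ t i, τ t * s i = (φ (FreeGroup.mk (c t i).1))⁻¹ * τ (t' t i)) {I : DominoInput d}
    (hI : 0 < I.1) {f : FreeGroup (Fin m) → ℕ} (hf : (bagRules c t' I).Labelling f) :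
    ∃ x ∈ nnSubshift s I.patterns, ∀ h t,
      bagLetter I.1 (f h) ((emptySite, t) : BagSite m k L) = x ((φ h)⁻¹ * τ t) := by
  let D := Equiv.ofBijective _ hbij
  let x : G → Fin I.1 := fun g =>
    ⟨bagLetter I.1 (f (D.symm g).1) ((emptySite, (D.symm g).2) : BagSite m k L), digit_lt hI _ _⟩
  have hx : ∀ h t, bagLetter I.1 (f h) ((emptySite, t) : BagSite m k L) =
      x ((φ h)⁻¹ * τ t) := by
    intro h t
    have : D.symm ((φ h)⁻¹ * τ t) = (h, t) := D.symm_apply_apply (h, t)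
    simp only [x, this]
  refine ⟨x, ?_, hx⟩
  rintro a b i hab ⟨g, hga, hgb⟩
  obtain ⟨⟨h, t⟩, rfl⟩ := hbij.2 g
  simp only at hga hgb
  rw [mul_assoc, hs, ← mul_assoc, ← mul_inv_rev, ← map_mul] at hgb
  refine (hf.1 h).2 t i ?_
  rw [hx, hga, bagLetter_labelling hf, hx, hgb]
  exact hab

lemma setOf_eq_infinite_iff
    (hbij : Function.Bijective fun p : FreeGroup (Fin m) × Fin k => (φ p.1)⁻¹ * τ p.2)
    {A : Type*} (x : G → A) (a : A) :
    {g | x g = a}.Infinite ↔ {h | ∃ t, x ((φ h)⁻¹ * τ t) = a}.Infinite := by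
  rw [← not_iff_not, Set.not_infinite, Set.not_infinite]
  constructor
  · intro h
    refine ((h.preimage hbij.1.injOn).image Prod.fst).subset ?_
    rintro g ⟨t, ht⟩
    exact ⟨(g, t), ht, rfl⟩
  · intro h
    refine ((h.prod (Set.finite_univ (α := Fin k))).image
      fun p => (φ p.1)⁻¹ * τ p.2).subset fun g hg => ?_
    obtain ⟨⟨h, t⟩, rfl⟩ := hbij.2 g
    exact ⟨(h, t), ⟨⟨t, hg⟩, trivial⟩, rfl⟩

/-- The seeded problem does not depend on the place of the seed, as the subshift is invariant under
translations. -/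
lemma SDP_iff_exists {I : DominoInput d} :
    SDP s I ↔ ∃ a₀ : Fin I.1, (a₀ : ℕ) = I.2.2 ∧ ∃ x ∈ nnSubshift s I.patterns, ∃ g, x g = a₀ := by
  refine exists_congr fun a => and_congr_right fun _ => ⟨fun ⟨x, hx, h⟩ => ⟨x, hx, 1, h⟩, ?_⟩
  rintro ⟨x, hx, g, hg⟩
  refine ⟨fun k => x (g * k), ?_, by simpa using hg⟩
  rintro a b i hab ⟨k, hk, hk'⟩
  exact hx a b i hab ⟨g * k, hk, by rwa [mul_assoc]⟩

lemma bagTarget_iff {I : DominoInput d} {f : FreeGroup (Fin m) → ℕ} {x : G → Fin I.1}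
    (hfx : ∀ h t, bagLetter I.1 (f h) ((emptySite, t) : BagSite m k L) = x ((φ h)⁻¹ * τ t))
    {a : Fin I.1} (ha : (a : ℕ) = I.2.2) (h : FreeGroup (Fin m)) :
    BagTarget m k L I (f h) ↔ ∃ t, x ((φ h)⁻¹ * τ t) = a := by
  have : I.2.2 < I.1 := ha ▸ a.2
  simp only [BagTarget, this, true_and, hfx, Fin.ext_iff, ha]

lemma SDP_iff_bagRules
    (hbij : Function.Bijective fun p : FreeGroup (Fin m) × Fin k => (φ p.1)⁻¹ * τ p.2)
    (hs : ∀ t i, τ t * s i = (φ (FreeGroup.mk (c t i).1))⁻¹ * τ (t' t i)) (I : DominoInput d) :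
    SDP s I ↔ ∃ f, (bagRules c t' I).Labelling f ∧ ∃ h, BagTarget m k L I (f h) := by
  rw [SDP_iff_exists]
  constructor
  · rintro ⟨a, ha, x, hx, g, hg⟩
    obtain ⟨f, hf, hfx⟩ := exists_labelling_of_mem_nnSubshift hs hx
    obtain ⟨⟨h, t⟩, rfl⟩ := hbij.2 g
    exact ⟨f, hf, h, (bagTarget_iff hfx ha h).2 ⟨t, hg⟩⟩
  · rintro ⟨f, hf, h, hP⟩
    obtain ⟨x, hx, hfx⟩ := exists_mem_nnSubshift_of_labelling hbij hs (Nat.zero_lt_of_lt hP.1) hf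
    obtain ⟨t, ht⟩ := (bagTarget_iff hfx (a := ⟨I.2.2, hP.1⟩) rfl h).1 hP
    exact ⟨⟨I.2.2, hP.1⟩, rfl, x, hx, _, ht⟩

lemma RDP_iff_bagRules
    (hbij : Function.Bijective fun p : FreeGroup (Fin m) × Fin k => (φ p.1)⁻¹ * τ p.2)
    (hs : ∀ t i, τ t * s i = (φ (FreeGroup.mk (c t i).1))⁻¹ * τ (t' t i)) (I : DominoInput d) :
    RDP s I ↔
      ∃ f, (bagRules c t' I).Labelling f ∧ {h | BagTarget m k L I (f h)}.Infinite := by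
  constructor
  · rintro ⟨a, ha, x, hx, hinf⟩
    obtain ⟨f, hf, hfx⟩ := exists_labelling_of_mem_nnSubshift hs hx
    refine ⟨f, hf, ?_⟩
    simp only [bagTarget_iff hfx ha]
    exact (setOf_eq_infinite_iff hbij x a).1 hinf
  · rintro ⟨f, hf, hinf⟩
    obtain ⟨h, hP⟩ := hinf.nonempty
    obtain ⟨x, hx, hfx⟩ := exists_mem_nnSubshift_of_labelling hbij hs (Nat.zero_lt_of_lt hP.1) hf
    refine ⟨⟨I.2.2, hP.1⟩, rfl, x, hx, (setOf_eq_infinite_iff hbij x _).2 ?_⟩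
    simpa only [bagTarget_iff hfx (a := ⟨I.2.2, hP.1⟩) rfl] using hinf

end Bags

/-! ### Decidability -/

theorem mainTheorem2 (G : Type*) [Group G] [Group.FG G] (hG : VirtuallyFree G) :
    SDPDecidable G ∧ RDPDecidable G := by
  obtain ⟨m, k, φ, τ, hbij⟩ := hG.exists_parametrization
  have key : ∀ (d : ℕ) (s : Fin d → G), ComputablePred (fun I : DominoInput d => SDP s I) ∧
      ComputablePred (fun I : DominoInput d => RDP s I) := by
    intro d s
    choose p hp using fun (t : Fin k) (i : Fin d) => hbij.2 (τ t * s i)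
    obtain ⟨L, hL⟩ : ∃ L, ∀ t i, (p t i).1.toWord.length ≤ L := by
      obtain ⟨L, hL⟩ := (Set.finite_range
        fun q : Fin k × Fin d => (p q.1 q.2).1.toWord.length).bddAbove
      exact ⟨L, fun t i => hL ⟨(t, i), rfl⟩⟩
    let c : Fin k → Fin d → {w : List (Fin m × Bool) // w.length ≤ L} :=
      fun t i => ⟨(p t i).1.toWord, hL t i⟩
    have hs : ∀ t i, τ t * s i = (φ (FreeGroup.mk (c t i).1))⁻¹ * τ (p t i).2 := by
      intro t i
      rw [FreeGroup.mk_toWord]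
      exact (hp t i).symm
    have hT := primrecFamily_bagRules (c := c) (t' := fun t i => (p t i).2)
    constructor
    · refine (PrimrecPred.of_eq (hT.exists_live (P := BagTarget m k L) primrecPred_bagTarget)
        fun I => ?_).computablePred
      rw [SDP_iff_bagRules hbij hs, TreeRules.exists_labelling_iff]
    · refine (PrimrecPred.of_eq (hT.recurrent (P := BagTarget m k L) primrecPred_bagTarget)
        fun I => ?_).computablePred
      rw [RDP_iff_bagRules hbij hs, TreeRules.exists_labelling_infinite_iff]
      exact (Set.finite_lt_nat _).subset (hT.lt_bound I)
  exact ⟨fun d s _ => (key d s).1, fun d s _ => (key d s).2⟩
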